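/- Posets are finite. Fix four types of intervals: type $A$ (endpoints closed, center point closed), type $B$ (endpoints open, center point open), type $C$ (endpoints closed, center point open) and type $D$ (endpoints open, center point closed). For a non-empty $S\subseteq\{A,B,C,D\}$, an $S$-representation of a poset $(X,\prec)$ assigns to each $x\in X$ a real interval $I_x$ of a type in $S$, with left endpoint $L(x)$, right endpoint $R(x)$ and center $c(x)=\tfrac12(L(x)+R(x))$, all intervals having the same positive length, such that for all $x,y\in X$ we have $x\prec y$ if and only if either $R(x)<c(y)$, or $R(x)=c(y)$, at least one of $R(x),c(y)$ is open, and at least one of $L(y),c(x)$ is open. An $S$-order is a poset that has an $S$-representation; we write $AB$-order for $\{A,B\}$-order, and so on. Let $\mathbf 2+\mathbf 2$ be the disjoint union of two $2$-element chains. Let $Z$ be the poset on $\{x,y,z,w,u,v\}$ with covering relations $x\prec y\prec z\prec w$, $x\prec v$, $u\prec w$. Let $H$ be the poset on $\{x,y,z,w,u,v\}$ with covering relations $x\prec y\prec z\prec w$, $y\prec u$, $v\prec z$. Proposition. Let $P$ be a finite poset. (i) If $P$ is a $CD$-order with no induced $\mathbf 2+\mathbf 2$, then $P$ is both an $AB$-order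 and an $AC$-order. (ii) If $P$ is an $AC$-order with no induced poset isomorphic to $Z$, then $P$ is both an $AB$-order and a $CD$-order. (iii) If $P$ is an $AB$-order with no induced poset isomorphic to $H$, then $P$ is both a $CD$-order and an $AC$-order. Moreover, no finite poset belongs to exactly two of the three classes of $AB$-orders, $AC$-orders and $CD$-orders: there is none that is an $AB$- and $AC$-order but not a $CD$-order, none that is an $AB$- and $CD$-order but not an $AC$-order, and none that is an $AC$- and $CD$-order but not an $AB$-order. -/

import Mathlib

namespace ABCDOrder

/-- The four types of unit intervals: `A` (endpoints and center closed), `B` (endpoints and center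
open), `C` (endpoints closed, center open), `D` (endpoints open, center closed). -/
inductive IntervalType
  | A | B | C | D

namespace IntervalType

/-- The endpoints of an interval of this type are open (types `B` and `D`). -/
def EndpointsOpen : IntervalType → Prop
  | A => False
  | B => True
  | C => False
  | D => True

/-- The center point of an interval of this type is open (types `B` and `C`). -/
def CenterOpen : IntervalType → Prop
  | A => False
  | B => True
  | C => True
  | D => False

end IntervalType

/-- A real interval given by its endpoints, together with one of the four types. -/
structure TypedInterval where
  left : ℝ
  right : ℝ
  type : IntervalType

namespace TypedInterval

/-- The center point of an interval. -/
noncomputable def center (I : TypedInterval) : ℝ := (I.left + I.right) / 2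

/-- Either `R(I) < c(J)`, or `R(I) = c(J)` where at least one of `R(I)`, `c(J)` is open and at
least one of `L(J)`, `c(I)` is open. -/
def Precedes (I J : TypedInterval) : Prop :=
  I.right < J.center ∨
    (I.right = J.center ∧
      (I.type.EndpointsOpen ∨ J.type.CenterOpen) ∧
      (J.type.EndpointsOpen ∨ I.type.CenterOpen))

end TypedInterval

/-- `I` is an `S`-representation of the poset `X`: all intervals have the same positive length
(unit intervals, up to scaling), all types belong to `S`, and `x < y` in the poset exactly when the
interval of `x` precedes that of `y`. -/
structure IsRepresentation (S : Set IntervalType) {X : Type*} [PartialOrder X]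
    (I : X → TypedInterval) : Prop where
  unit_length : ∃ len : ℝ, 0 < len ∧ ∀ x, (I x).right - (I x).left = len
  type_mem : ∀ x, (I x).type ∈ S
  lt_iff : ∀ x y, x < y ↔ (I x).Precedes (I y)

/-- An `S`-order is a poset with an `S`-representation. -/
def IsSOrder (S : Set IntervalType) (X : Type*) [PartialOrder X] : Prop :=
  ∃ I : X → TypedInterval, IsRepresentation S I

/-- The poset `X` has no induced subposet isomorphic to `Q`. -/
def NoInduced (Q X : Type*) [PartialOrder Q] [PartialOrder X] : Prop :=
  IsEmpty (Q ↪o X)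

/-- The poset `2 + 2`: the disjoint union of two chains with two elements each
(elements of different summands are incomparable). -/
abbrev TwoPlusTwo : Type := Fin 2 ⊕ Fin 2

/-- The ground set of the poset `Z`. -/
inductive PosetZ
  | x | y | z | w | u | v

/-- The strict order of `Z`: the chain `x < y < z < w` together with `x < v` and `u < w`. -/
def PosetZ.below : PosetZ → PosetZ → Prop
  | .x, .y => True
  | .x, .z => True
  | .x, .w => True
  | .y, .z => True
  | .y, .w => True
  | .z, .w => True
  | .x, .v => True
  | .u, .w => True
  | _, _ => False

instance : PartialOrder PosetZ where
  le a b := a = b ∨ a.below b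
  le_refl a := Or.inl rfl
  le_trans a b c := by cases a <;> cases b <;> cases c <;> simp [PosetZ.below]
  lt a b := a.below b
  lt_iff_le_not_ge a b := by cases a <;> cases b <;> simp [PosetZ.below]
  le_antisymm a b := by cases a <;> cases b <;> simp [PosetZ.below]

/-- The ground set of the poset `H`. -/
inductive PosetH
  | x | y | z | w | u | v

/-- The strict order of `H`: the chain `x < y < z < w` together with `y < u` and `v < z`, and
the relations `x < u` and `v < w` that follow by transitivity. -/
def PosetH.below : PosetH → PosetH → Prop
  | .x, .y => True
  | .x, .z => True
  | .x, .w => True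
  | .y, .z => True
  | .y, .w => True
  | .z, .w => True
  | .y, .u => True
  | .v, .z => True
  | .x, .u => True
  | .v, .w => True
  | _, _ => False

instance : PartialOrder PosetH where
  le a b := a = b ∨ a.below b
  le_refl a := Or.inl rfl
  le_trans a b c := by cases a <;> cases b <;> cases c <;> simp [PosetH.below]
  lt a b := a.below b
  lt_iff_le_not_ge a b := by cases a <;> cases b <;> simp [PosetH.below]
  le_antisymm a b := by cases a <;> cases b <;> simp [PosetH.below]

/-- `AB`-orders. -/
abbrev IsABOrder (X : Type*) [PartialOrder X] : Prop :=
  IsSOrder {IntervalType.A, IntervalType.B} X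

/-- `AC`-orders. -/
abbrev IsACOrder (X : Type*) [PartialOrder X] : Prop :=
  IsSOrder {IntervalType.A, IntervalType.C} X

/-- `CD`-orders. -/
abbrev IsCDOrder (X : Type*) [PartialOrder X] : Prop :=
  IsSOrder {IntervalType.C, IntervalType.D} X

end ABCDOrder

namespace ABCDOrder

/-! After scaling the half-length to 1, a representation is a point and a bit per element. Types
matter only for pairs at distance exactly 1, where comparability is an operation on the two bits:
`or` for AB, `and` for AC, equality for CD.

An infinitesimal move changes only pairs at distance 1: some become strictly comparable, some
strictly incomparable, and the rest stay tied for the new operation `ψ` to decide. All three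
operations have a unit `κ`. If among tied pairs one bit is always `κ`, then `ψ` returns the other
bit, whichever `ψ` is; hence one construction serves every target class. It fails only when two
consecutive positions both need their bits, and such positions contain an induced 2+2, Z or H
(`IsModel.of_eq`, `IsModel.of_and`, `IsModel.of_or`).

For the last claim, AB- and AC-orders contain no 2+2 and AB-orders contain no Z, so membership in
two classes supplies the hypothesis needed to reach the third. -/

/-- A poset given by points `c` and bits `t`: elements at distance more than one are compared as
their points, those at distance exactly one are compared according to `φ`. -/
def IsModel {X : Type*} [LT X] (φ : Bool → Bool → Bool) (c : X → ℝ) (t : X → Bool) : Prop :=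
  ∀ x y, x < y ↔ c x + 1 < c y ∨ (c x + 1 = c y ∧ φ (t x) (t y) = true)

/-- Some element located at `p` carries the bit `b`. -/
def Has {X : Type*} (c : X → ℝ) (t : X → Bool) (p : ℝ) (b : Bool) : Prop :=
  ∃ x, c x = p ∧ t x = b

theorem isSOrder_pair_iff {X : Type*} [PartialOrder X] (T₀ T₁ : IntervalType) (hne : T₀ ≠ T₁)
    (φ : Bool → Bool → Bool)
    (hφ : ∀ a b : Bool, φ a b = true ↔
      ((cond a T₁ T₀).EndpointsOpen ∨ (cond b T₁ T₀).CenterOpen) ∧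
      ((cond b T₁ T₀).EndpointsOpen ∨ (cond a T₁ T₀).CenterOpen)) :
    IsSOrder {T₀, T₁} X ↔ ∃ (c : X → ℝ) (t : X → Bool), IsModel φ c t := by
  classical
  constructor
  · rintro ⟨I, ⟨len, hlen, hI⟩, hmem, hlt⟩
    refine ⟨fun x => (I x).center / (len / 2), fun x => decide ((I x).type = T₁), fun x y => ?_⟩
    have htype : ∀ x, cond (decide ((I x).type = T₁)) T₁ T₀ = (I x).type := by
      intro x
      rcases hmem x with h | h
      · simp [h, hne]
      · simp only [Set.mem_singleton_iff] at h
        simp [h]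
    have hright : (I x).right = (I x).center + len / 2 := by
      have := hI x
      unfold TypedInterval.center
      linarith
    have h2 : 0 < len / 2 := by positivity
    have hadd : (I x).center / (len / 2) + 1 = ((I x).center + len / 2) / (len / 2) := by
      field_simp
    rw [hlt, TypedInterval.Precedes, hφ, htype, htype, hadd, hright,
      div_lt_div_iff_of_pos_right h2, div_left_inj' h2.ne']
  · rintro ⟨c, t, h⟩
    refine ⟨fun x => ⟨c x - 1, c x + 1, cond (t x) T₁ T₀⟩, ⟨2, by norm_num, fun x => ?_⟩,
      fun x => ?_, fun x y => ?_⟩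
    · show c x + 1 - (c x - 1) = 2
      ring
    · show cond (t x) T₁ T₀ ∈ _
      cases t x <;> simp
    · have hc : (c y - 1 + (c y + 1)) / 2 = c y := by ring
      rw [h, hφ]
      simp only [TypedInterval.Precedes, TypedInterval.center, hc]

theorem isABOrder_iff {X : Type*} [PartialOrder X] :
    IsABOrder X ↔ ∃ (c : X → ℝ) (t : X → Bool), IsModel or c t :=
  isSOrder_pair_iff _ _ (by simp) _ (by
    rintro (_ | _) (_ | _) <;> simp [IntervalType.EndpointsOpen, IntervalType.CenterOpen])

theorem isACOrder_iff {X : Type*} [PartialOrder X] :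
    IsACOrder X ↔ ∃ (c : X → ℝ) (t : X → Bool), IsModel and c t :=
  isSOrder_pair_iff _ _ (by simp) _ (by
    rintro (_ | _) (_ | _) <;> simp [IntervalType.EndpointsOpen, IntervalType.CenterOpen])

theorem isCDOrder_iff {X : Type*} [PartialOrder X] :
    IsCDOrder X ↔ ∃ (c : X → ℝ) (t : X → Bool), IsModel (fun a b => !xor a b) c t := by
  have hpair : ({IntervalType.C, IntervalType.D} : Set IntervalType) =
    {IntervalType.D, IntervalType.C} := Set.pair_comm _ _
  unfold IsCDOrder
  rw [hpair]
  exact isSOrder_pair_iff _ _ (by simp) _ (by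
    rintro (_ | _) (_ | _) <;> simp [IntervalType.EndpointsOpen, IntervalType.CenterOpen])

/-! ### Infinitesimal moves of the points -/

/-- A function on a finite set of reals with prescribed increments along steps of length one. -/
theorem exists_potential (P : Finset ℝ) (s : ℝ → ℝ) :
    ∃ F : ℝ → ℝ, ∀ p ∈ P, F (p + 1) = F p + s p := by
  classical
  -- Sum the increments over all points of `P` lying a positive integer below `p`; passing to `p +
  -- 1` adds exactly the term at `p`.
  refine ⟨fun p => ∑ q ∈ P with ∃ n : ℕ, p = q + (n + 1), s q, fun p hp => ?_⟩
  have hset : P.filter (fun q => ∃ n : ℕ, p + 1 = q + (n + 1)) =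
      insert p (P.filter (fun q => ∃ n : ℕ, p = q + (n + 1))) := by
    ext q
    simp only [Finset.mem_filter, Finset.mem_insert]
    constructor
    · rintro ⟨hq, n, hn⟩
      cases n with
      | zero => left; push_cast at hn; linarith
      | succ k => exact Or.inr ⟨hq, k, by push_cast at hn; linarith⟩
    · rintro (rfl | ⟨hq, n, hn⟩)
      · exact ⟨hp, 0, by push_cast; ring⟩
      · exact ⟨hq, n + 1, by push_cast; linarith⟩
  have hnot : p ∉ P.filter (fun q => ∃ n : ℕ, p = q + (n + 1)) := by
    simp only [Finset.mem_filter, not_and, not_exists]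
    intro _ n hn
    have : (0 : ℝ) ≤ n := n.cast_nonneg
    linarith
  show ∑ q ∈ P.filter (fun q => ∃ n : ℕ, p + 1 = q + (n + 1)), s q = _
  rw [hset, Finset.sum_insert hnot, add_comm]

/-- Small perturbations of finitely many points preserve strict comparisons of distances with
one. -/
theorem exists_small_perturbation {X : Type*} [Finite X] (c f : X → ℝ) :
    ∃ ε : ℝ, 0 < ε ∧ ∀ x y,
      (c x + 1 < c y → c x + ε * f x + 1 < c y + ε * f y) ∧
      (c y < c x + 1 → c y + ε * f y < c x + ε * f x + 1) := by
  have hev : ∀ a b d e : ℝ, a < b → ∀ᶠ ε in nhdsWithin (0 : ℝ) (Set.Ioi 0),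
      a + ε * d < b + ε * e := by
    intro a b d e hab
    apply nhdsWithin_le_nhds
    have h1 : Continuous fun ε : ℝ => a + ε * d := by fun_prop
    have h2 : Continuous fun ε : ℝ => b + ε * e := by fun_prop
    exact h1.continuousAt.eventually_lt h2.continuousAt (by simpa using hab)
  have hall : ∀ᶠ ε in nhdsWithin (0 : ℝ) (Set.Ioi 0), 0 < ε ∧ ∀ x y,
      (c x + 1 < c y → c x + ε * f x + 1 < c y + ε * f y) ∧
      (c y < c x + 1 → c y + ε * f y < c x + ε * f x + 1) := by
    refine Filter.Eventually.and self_mem_nhdsWithin ?_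
    rw [Filter.eventually_all]
    intro x
    rw [Filter.eventually_all]
    intro y
    refine Filter.Eventually.and ?_ ?_
    · by_cases h : c x + 1 < c y
      · filter_upwards [hev _ _ (f x) (f y) h] with ε hε _
        linarith
      · exact Filter.Eventually.of_forall fun _ h' => absurd h' h
    · by_cases h : c y < c x + 1
      · filter_upwards [hev _ _ (f y) (f x) h] with ε hε _
        linarith
      · exact Filter.Eventually.of_forall fun _ h' => absurd h' h
  exact hall.exists

/-- A model with respect to `φ` becomes a model with respect to `ψ` by an infinitesimal move, given
by a step function `s` on the line and an offset `o` of each element. -/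
theorem IsModel.perturb {X : Type*} [LT X] [Finite X] {φ ψ : Bool → Bool → Bool} {c : X → ℝ}
    {t : X → Bool} (h : IsModel φ c t) (s : ℝ → ℝ) (o : X → ℝ) (u : X → Bool)
    (hs : ∀ x y, c x + 1 = c y → (φ (t x) (t y) = true ↔
      0 < s (c x) + o y - o x ∨ (s (c x) + o y - o x = 0 ∧ ψ (u x) (u y) = true))) :
    ∃ (c : X → ℝ) (t : X → Bool), IsModel ψ c t := by
  obtain ⟨F, hF⟩ := exists_potential (Set.finite_range c).toFinset s
  have hF' : ∀ x, F (c x + 1) = F (c x) + s (c x) := fun x => hF _ (by simp)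
  obtain ⟨ε, hε, hsmall⟩ := exists_small_perturbation c (fun x => F (c x) + o x)
  refine ⟨fun x => c x + ε * (F (c x) + o x), u, fun x y => ?_⟩
  rw [h x y]
  rcases lt_trichotomy (c x + 1) (c y) with hlt | heq | hgt
  · simp [hlt, (hsmall x y).1 hlt]
  · have hd : c y + ε * (F (c y) + o y) - (c x + ε * (F (c x) + o x) + 1) =
        ε * (s (c x) + o y - o x) := by
      rw [← heq, hF']
      ring
    have h1 : c x + ε * (F (c x) + o x) + 1 < c y + ε * (F (c y) + o y) ↔
        0 < s (c x) + o y - o x := by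
      rw [← sub_pos, hd, mul_pos_iff_of_pos_left hε]
    have h2 : c x + ε * (F (c x) + o x) + 1 = c y + ε * (F (c y) + o y) ↔
        s (c x) + o y - o x = 0 := by
      rw [eq_comm, ← sub_eq_zero, hd, mul_eq_zero, or_iff_right hε.ne']
    rw [h1, h2, ← hs x y heq]
    simp [heq]
  · have := (hsmall x y).2 hgt
    simp [not_lt_of_gt hgt, hgt.ne', not_lt_of_gt this, this.ne']

/-! ### Replacing one operation by another -/

/-- If conjunction governs the pairs at distance one and no two consecutive positions with both
bits are preceded and followed by positions with the bit `true`, then any operation with a unit can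
replace conjunction. -/
theorem exists_perturbation_and {X : Type*} (c : X → ℝ) (t : X → Bool)
    (hno : ∀ p, ¬ (Has c t p true ∧ Has c t (p + 1) true ∧ Has c t (p + 1) false ∧
      Has c t (p + 2) true ∧ Has c t (p + 2) false ∧ Has c t (p + 3) true))
    (ψ : Bool → Bool → Bool) (κ : Bool) (hl : ∀ b, ψ κ b = b) (hr : ∀ b, ψ b κ = b) :
    ∃ (s : ℝ → ℝ) (o : X → ℝ) (u : X → Bool), ∀ x y, c x + 1 = c y →
      ((t x && t y) = true ↔
        0 < s (c x) + o y - o x ∨ (s (c x) + o y - o x = 0 ∧ ψ (u x) (u y) = true)) := by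
  classical
  -- Only at inner positions does each bit have to stay tied to both sides; `hno` says that no two
  -- of them are consecutive.
  obtain ⟨inner, hinner⟩ : ∃ inner : ℝ → Prop, ∀ p, inner p ↔
      Has c t p false ∧ Has c t p true ∧ Has c t (p - 1) true ∧ Has c t (p + 1) true :=
    ⟨_, fun _ => Iff.rfl⟩
  -- Offsets lie in [-2, 2], so -5 makes every pair across the step incomparable. A step of 1 makes
  -- `true` pairs comparable, yet an offset of size 2 overrides it. Steps next to an inner position
  -- are ties.
  let s : ℝ → ℝ := fun p => if Has c t p true ∧ Has c t (p + 1) true then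
    (if inner p ∨ inner (p + 1) then 0 else 1) else -5
  -- A `false` element sharing its position with a `true` one must be incomparable to both sides. If
  -- one side has no `true` element, the step there is -5 already, so the element can move towards
  -- that side's opposite.
  let o : X → ℝ := fun x => if t x = false ∧ Has c t (c x) true then
    (if ¬ Has c t (c x - 1) true then 2 else if ¬ Has c t (c x + 1) true then -2 else 0) else 0
  let u : X → Bool := fun x => if inner (c x) then t x else κ
  refine ⟨s, o, u, fun x y hxy => ?_⟩
  have hx : Has c t (c x) (t x) := ⟨x, rfl, rfl⟩
  have hy : Has c t (c x + 1) (t y) := ⟨y, hxy.symm, rfl⟩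
  have e1 : c x + 1 - 1 = c x := by ring
  have e2 : c x + 1 + 1 = c x + 2 := by ring
  have hno' := hno (c x - 1)
  rw [show c x - 1 + 1 = c x by ring, show c x - 1 + 2 = c x + 1 by ring,
    show c x - 1 + 3 = c x + 2 by ring] at hno'
  simp only [s, o, u, hinner, ← hxy, e1, e2]
  clear hinner hno hxy s o u
  -- The claim now depends only on which bits occur at the four positions from `p - 1` to `p + 2`: a
  -- finite check.
  generalize c x = p at *
  by_cases a0 : Has c t (p - 1) true <;> by_cases a1 : Has c t p true <;>
  by_cases a2 : Has c t (p + 1) true <;> by_cases a3 : Has c t (p + 2) true <;>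
  by_cases b1 : Has c t p false <;> by_cases b2 : Has c t (p + 1) false <;>
  rcases htx : t x with _ | _ <;> rcases hty : t y with _ | _ <;>
  simp only [htx, hty] at hx hy <;>
  first
  | exact absurd hx ‹_›
  | exact absurd hy ‹_›
  | (refine absurd ?_ hno'; refine ⟨?_, ?_, ?_, ?_, ?_, ?_⟩ <;> assumption)
  | norm_num [a0, a1, a2, a3, b1, b2, hl, hr]

/-- If equality governs the pairs at distance one and no two consecutive positions have both bits,
then any operation with a unit can replace equality. -/
theorem exists_perturbation_eq {X : Type*} (c : X → ℝ) (t : X → Bool)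
    (hno : ∀ p, ¬ (Has c t p true ∧ Has c t p false ∧ Has c t (p + 1) true ∧
      Has c t (p + 1) false))
    (ψ : Bool → Bool → Bool) (κ : Bool) (hl : ∀ b, ψ κ b = b) (hr : ∀ b, ψ b κ = b) :
    ∃ (s : ℝ → ℝ) (o : X → ℝ) (u : X → Bool), ∀ x y, c x + 1 = c y →
      ((!xor (t x) (t y)) = true ↔
        0 < s (c x) + o y - o x ∨ (s (c x) + o y - o x = 0 ∧ ψ (u x) (u y) = true)) := by
  classical
  obtain ⟨full, hfull⟩ : ∃ full : ℝ → Prop, ∀ p, full p ↔ Has c t p true ∧ Has c t p false :=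
    ⟨_, fun _ => Iff.rfl⟩
  let s : ℝ → ℝ := fun p => if full p ∨ full (p + 1) then 0 else
    if (Has c t p true ∧ Has c t (p + 1) true) ∨ (Has c t p false ∧ Has c t (p + 1) false) then 1
    else -1
  -- The positions next to a full one carry at most one bit each. If an element agrees with its
  -- predecessors and not its successors, moving right settles both sides; in the opposite case it
  -- moves left.
  let o : X → ℝ := fun x => if full (c x) then
    (if Has c t (c x - 1) (t x) ∧ Has c t (c x + 1) (!t x) then 1 else
      if Has c t (c x - 1) (!t x) ∧ Has c t (c x + 1) (t x) then -1 else 0) else 0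
  -- With offset 0, no two neighbouring sides make opposite demands, so a single bit tells whether
  -- the tied element is comparable to its neighbours, which carry `κ`.
  let u : X → Bool := fun x => if full (c x) then
    decide (Has c t (c x - 1) (t x) ∨ Has c t (c x + 1) (t x)) else κ
  refine ⟨s, o, u, fun x y hxy => ?_⟩
  have hx : Has c t (c x) (t x) := ⟨x, rfl, rfl⟩
  have hy : Has c t (c x + 1) (t y) := ⟨y, hxy.symm, rfl⟩
  have e1 : c x + 1 - 1 = c x := by ring
  have e2 : c x + 1 + 1 = c x + 2 := by ring
  have h0 := hno (c x - 1)
  rw [show c x - 1 + 1 = c x by ring] at h0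
  have h1 := hno (c x)
  have h2 := hno (c x + 1)
  rw [e2] at h2
  simp only [s, o, u, hfull, ← hxy, e1, e2]
  clear hfull hno hxy s o u
  generalize c x = p at *
  by_cases d1 : Has c t p true <;> by_cases b1 : Has c t p false <;>
  by_cases d2 : Has c t (p + 1) true <;> by_cases b2 : Has c t (p + 1) false <;>
  rcases htx : t x with _ | _ <;> rcases hty : t y with _ | _ <;>
  simp only [htx, hty] at hx hy <;>
  first
  | exact absurd hx ‹_›
  | exact absurd hy ‹_›
  | (refine absurd ?_ h1; refine ⟨?_, ?_, ?_, ?_⟩ <;> assumption)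
  | (by_cases d0 : Has c t (p - 1) true <;> by_cases b0 : Has c t (p - 1) false <;>
     by_cases d3 : Has c t (p + 2) true <;> by_cases b3 : Has c t (p + 2) false <;>
     first
     | (refine absurd ?_ h0; refine ⟨?_, ?_, ?_, ?_⟩ <;> assumption)
     | (refine absurd ?_ h2; refine ⟨?_, ?_, ?_, ?_⟩ <;> assumption)
     | norm_num [d0, d1, d2, d3, b0, b1, b2, b3, hl, hr])

theorem IsModel.of_and {X : Type*} [LT X] [Finite X] {c : X → ℝ} {t : X → Bool}
    (h : IsModel and c t)
    (hno : ∀ p, ¬ (Has c t p true ∧ Has c t (p + 1) true ∧ Has c t (p + 1) false ∧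
      Has c t (p + 2) true ∧ Has c t (p + 2) false ∧ Has c t (p + 3) true))
    (ψ : Bool → Bool → Bool) (κ : Bool) (hl : ∀ b, ψ κ b = b) (hr : ∀ b, ψ b κ = b) :
    ∃ (c : X → ℝ) (t : X → Bool), IsModel ψ c t := by
  obtain ⟨s, o, u, hs⟩ := exists_perturbation_and c t hno ψ κ hl hr
  exact h.perturb s o u hs

theorem IsModel.of_or {X : Type*} [LT X] [Finite X] {c : X → ℝ} {t : X → Bool}
    (h : IsModel or c t)
    (hno : ∀ p, ¬ (Has c t p false ∧ Has c t (p + 1) true ∧ Has c t (p + 1) false ∧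
      Has c t (p + 2) true ∧ Has c t (p + 2) false ∧ Has c t (p + 3) false))
    (ψ : Bool → Bool → Bool) (κ : Bool) (hl : ∀ b, ψ κ b = b) (hr : ∀ b, ψ b κ = b) :
    ∃ (c : X → ℝ) (t : X → Bool), IsModel ψ c t := by
  have hhas : ∀ p b, Has c (fun x => !t x) p b ↔ Has c t p (!b) := by
    intro p b
    simp only [Has, Bool.not_eq_eq_eq_not]
  obtain ⟨s, o, u, hs⟩ := exists_perturbation_and c (fun x => !t x)
    (by
      intro p hp
      simp only [hhas, Bool.not_true, Bool.not_false] at hp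
      exact hno p ⟨hp.1, hp.2.2.1, hp.2.1, hp.2.2.2.2.1, hp.2.2.2.1, hp.2.2.2.2.2⟩)
    (fun a b => !ψ (!a) (!b)) (!κ) (by simp [hl]) (by simp [hr])
  -- De Morgan duality: negating the bits turns `or` into `and` with comparability negated, and
  -- reversing the move negates its outcome.
  refine h.perturb (fun p => -s p) (fun x => -o x) (fun x => !u x) fun x y hxy => ?_
  have hneg : -s (c x) + -o y - -o x = -(s (c x) + o y - o x) := by ring
  have := hs x y hxy
  rw [hneg]
  generalize s (c x) + o y - o x = r at *
  rw [← not_iff_not]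
  rw [show (¬ (t x || t y) = true) ↔ (!t x && !t y) = true by cases t x <;> cases t y <;> simp,
    this]
  rcases lt_trichotomy r 0 with hr | hr | hr
  · simp [hr.ne, hr, hr.not_gt]
  · simp [hr]
  · simp [hr.ne', hr, hr.le]

theorem IsModel.of_eq {X : Type*} [LT X] [Finite X] {c : X → ℝ} {t : X → Bool}
    (h : IsModel (fun a b => !xor a b) c t)
    (hno : ∀ p, ¬ (Has c t p true ∧ Has c t p false ∧ Has c t (p + 1) true ∧
      Has c t (p + 1) false))
    (ψ : Bool → Bool → Bool) (κ : Bool) (hl : ∀ b, ψ κ b = b) (hr : ∀ b, ψ b κ = b) :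
    ∃ (c : X → ℝ) (t : X → Bool), IsModel ψ c t := by
  obtain ⟨s, o, u, hs⟩ := exists_perturbation_eq c t hno ψ κ hl hr
  exact h.perturb s o u hs

/-! ### Forbidden subposets inside the obstructing configurations -/

/-- A map of posets that preserves and reflects the strict order, and is injective, rules out
`NoInduced`. -/
theorem NoInduced.false_of_lt_iff {Q X : Type*} [PartialOrder Q] [PartialOrder X]
    (h : NoInduced Q X) (f : Q → X) (hinj : Function.Injective f)
    (hf : ∀ a b, f a < f b ↔ a < b) : False :=
  h.false ⟨⟨f, hinj⟩, by
    intro a b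
    show f a ≤ f b ↔ a ≤ b
    rw [le_iff_lt_or_eq, le_iff_lt_or_eq, hf, hinj.eq_iff]⟩

theorem PosetZ.lt_iff (a b : PosetZ) : a < b ↔ a.below b := Iff.rfl

theorem PosetH.lt_iff (a b : PosetH) : a < b ↔ a.below b := Iff.rfl

/-- Under equality, the two bits at consecutive positions form two chains with no relation between
them. -/
theorem IsModel.no_consecutive_of_noInduced_twoPlusTwo {X : Type*} [PartialOrder X] {c : X → ℝ}
    {t : X → Bool} (h : IsModel (fun a b => !xor a b) c t) (hX : NoInduced TwoPlusTwo X) (p : ℝ) :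
    ¬ (Has c t p true ∧ Has c t p false ∧ Has c t (p + 1) true ∧ Has c t (p + 1) false) := by
  rintro ⟨⟨a, ha, ta⟩, ⟨b, hb, tb⟩, ⟨a', ha', ta'⟩, ⟨b', hb', tb'⟩⟩
  let f : TwoPlusTwo → X := Sum.elim ![a, a'] ![b, b']
  refine hX.false_of_lt_iff f ?_ ?_
  · have hcf : Function.Injective fun i => (c (f i), t (f i)) := by
      rintro (i | i) (j | j) <;> fin_cases i <;> fin_cases j <;>
        simp [f, ha, hb, ha', hb', ta, tb, ta', tb']
    exact fun i j hij => hcf (by simp only [hij])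
  · rintro (i | i) (j | j) <;> fin_cases i <;> fin_cases j <;>
      simp [f, h _ _, ha, hb, ha', hb', ta, tb, ta', tb', add_assoc]

theorem IsModel.no_consecutive_of_noInduced_posetZ {X : Type*} [PartialOrder X] {c : X → ℝ}
    {t : X → Bool} (h : IsModel and c t) (hX : NoInduced PosetZ X) (p : ℝ) :
    ¬ (Has c t p true ∧ Has c t (p + 1) true ∧ Has c t (p + 1) false ∧
      Has c t (p + 2) true ∧ Has c t (p + 2) false ∧ Has c t (p + 3) true) := by
  rintro ⟨⟨x, hx, tx⟩, ⟨y, hy, ty⟩, ⟨u, hu, tu⟩, ⟨z, hz, tz⟩, ⟨v, hv, tv⟩, ⟨w, hw, tw⟩⟩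
  let f : PosetZ → X := fun i => PosetZ.casesOn i x y z w u v
  refine hX.false_of_lt_iff f ?_ ?_
  · have hcf : Function.Injective fun i => (c (f i), t (f i)) := by
      intro i j
      cases i <;> cases j <;> simp [f, hx, hy, hz, hw, hu, hv, tx, ty, tz, tw, tu, tv]
    exact fun i j hij => hcf (by simp only [hij])
  · intro i j
    rw [PosetZ.lt_iff, h]
    cases i <;> cases j <;>
      simp [f, PosetZ.below, hx, hy, hz, hw, hu, hv, tx, ty, tz, tw, tu, tv, add_assoc] <;>
      norm_num

theorem IsModel.no_consecutive_of_noInduced_posetH {X : Type*} [PartialOrder X] {c : X → ℝ}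
    {t : X → Bool} (h : IsModel or c t) (hX : NoInduced PosetH X) (p : ℝ) :
    ¬ (Has c t p false ∧ Has c t (p + 1) true ∧ Has c t (p + 1) false ∧
      Has c t (p + 2) true ∧ Has c t (p + 2) false ∧ Has c t (p + 3) false) := by
  rintro ⟨⟨x, hx, tx⟩, ⟨y, hy, ty⟩, ⟨v, hv, tv⟩, ⟨z, hz, tz⟩, ⟨u, hu, tu⟩, ⟨w, hw, tw⟩⟩
  let f : PosetH → X := fun i => PosetH.casesOn i x y z w u v
  refine hX.false_of_lt_iff f ?_ ?_
  · have hcf : Function.Injective fun i => (c (f i), t (f i)) := by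
      intro i j
      cases i <;> cases j <;> simp [f, hx, hy, hz, hw, hu, hv, tx, ty, tz, tw, tu, tv]
    exact fun i j hij => hcf (by simp only [hij])
  · intro i j
    rw [PosetH.lt_iff, h]
    cases i <;> cases j <;>
      simp [f, PosetH.below, hx, hy, hz, hw, hu, hv, tx, ty, tz, tw, tu, tv, add_assoc] <;>
      norm_num

/-! ### Subposets excluded from AB- and AC-orders -/

/-- In a model, two comparable pairs that are not comparable crosswise are all at distance one. -/
theorem IsModel.eq_of_lt_of_not_lt {X : Type*} [LT X] {φ : Bool → Bool → Bool} {c : X → ℝ}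
    {t : X → Bool} (h : IsModel φ c t) {a b d e : X} (hab : a < b) (hde : d < e) (hae : ¬ a < e)
    (hdb : ¬ d < b) :
    φ (t a) (t b) = true ∧ φ (t d) (t e) = true ∧ φ (t a) (t e) ≠ true ∧ φ (t d) (t b) ≠ true := by
  rw [h, not_or, not_and] at hae hdb
  rw [h] at hab hde
  have h1 := hae.1
  have h2 := hdb.1
  have h3 : c a + 1 ≤ c b := hab.elim le_of_lt fun h => h.1.le
  have h4 : c d + 1 ≤ c e := hde.elim le_of_lt fun h => h.1.le
  refine ⟨(hab.resolve_left ?_).2, (hde.resolve_left ?_).2, hae.2 ?_, hdb.2 ?_⟩ <;> linarith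

/-- The hypothesis on `φ` says that `φ`, as a relation on bits, has no crossing pattern; `or` and
`and` satisfy it, equality does not. -/
theorem IsModel.noInduced_twoPlusTwo {X : Type*} [PartialOrder X] {φ : Bool → Bool → Bool}
    {c : X → ℝ} {t : X → Bool} (h : IsModel φ c t)
    (hφ : ∀ a b d e, φ a b = true → φ d e = true → φ a e = true ∨ φ d b = true) :
    NoInduced TwoPlusTwo X := by
  refine ⟨fun f => ?_⟩
  obtain ⟨h1, h2, h3, h4⟩ := h.eq_of_lt_of_not_lt (a := f (Sum.inl 0)) (b := f (Sum.inl 1))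
    (d := f (Sum.inr 0)) (e := f (Sum.inr 1)) (by simp) (by simp) (by simp) (by simp)
  exact (hφ _ _ _ _ h1 h2).elim h3 h4

theorem IsModel.noInduced_posetZ {X : Type*} [PartialOrder X] {c : X → ℝ} {t : X → Bool}
    (h : IsModel or c t) : NoInduced PosetZ X := by
  refine ⟨fun f => ?_⟩
  have hf : ∀ i j, PosetZ.below i j ↔
      c (f i) + 1 < c (f j) ∨ (c (f i) + 1 = c (f j) ∧ (t (f i) || t (f j)) = true) := by
    intro i j
    rw [← h, f.lt_iff_lt, PosetZ.lt_iff]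
  have hle : ∀ i j, PosetZ.below i j → c (f i) + 1 ≤ c (f j) := fun i j hij =>
    ((hf i j).1 hij).elim le_of_lt fun h => h.1.le
  have hge : ∀ i j, ¬ PosetZ.below i j → c (f j) ≤ c (f i) + 1 := fun i j hij =>
    not_lt.1 fun h' => hij ((hf i j).2 (Or.inl h'))
  have xy := hle .x .y (by simp [PosetZ.below])
  have yz := hle .y .z (by simp [PosetZ.below])
  have zw := hle .z .w (by simp [PosetZ.below])
  have xu := hge .x .u (by simp [PosetZ.below])
  have uz := hge .u .z (by simp [PosetZ.below])
  have yv := hge .y .v (by simp [PosetZ.below])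
  have vw := hge .v .w (by simp [PosetZ.below])
  have hyz := (hf .y .z).1 (by simp [PosetZ.below])
  have huz := mt (hf .u .z).2 (by simp [PosetZ.below])
  have hyv := mt (hf .y .v).2 (by simp [PosetZ.below])
  -- The distance bounds are tight: `u` is forced onto the point of `y` and `v` onto that of `z`,
  -- one unit apart. Then `u ≮ z` and `y ≮ v` make the bits of `z` and `y` false, against `y < z`.
  have e1 : c (f .u) + 1 = c (f .z) := by linarith
  have e2 : c (f .y) + 1 = c (f .v) := by linarith
  have e3 : ¬ c (f .v) < c (f .z) := by linarith
  simp only [e1, e2, e3, true_and, false_or, not_or, Bool.or_eq_true] at hyz huz hyv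
  tauto

end ABCDOrder

theorem ABCDOrder.isABOrder_and_isACOrder_of_isCDOrder {X : Type*} [PartialOrder X] [Finite X]
    (h : IsCDOrder X) (hX : NoInduced TwoPlusTwo X) : IsABOrder X ∧ IsACOrder X := by
  obtain ⟨c, t, h⟩ := isCDOrder_iff.1 h
  have hno := h.no_consecutive_of_noInduced_twoPlusTwo hX
  exact ⟨isABOrder_iff.2 (h.of_eq hno or false (by simp) (by simp)),
    isACOrder_iff.2 (h.of_eq hno and true (by simp) (by simp))⟩

theorem ABCDOrder.isABOrder_and_isCDOrder_of_isACOrder {X : Type*} [PartialOrder X] [Finite X]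
    (h : IsACOrder X) (hX : NoInduced PosetZ X) : IsABOrder X ∧ IsCDOrder X := by
  obtain ⟨c, t, h⟩ := isACOrder_iff.1 h
  have hno := h.no_consecutive_of_noInduced_posetZ hX
  exact ⟨isABOrder_iff.2 (h.of_and hno or false (by simp) (by simp)),
    isCDOrder_iff.2 (h.of_and hno _ true (by simp) (by simp))⟩

theorem ABCDOrder.isCDOrder_and_isACOrder_of_isABOrder {X : Type*} [PartialOrder X] [Finite X]
    (h : IsABOrder X) (hX : NoInduced PosetH X) : IsCDOrder X ∧ IsACOrder X := by
  obtain ⟨c, t, h⟩ := isABOrder_iff.1 h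
  have hno := h.no_consecutive_of_noInduced_posetH hX
  exact ⟨isCDOrder_iff.2 (h.of_or hno _ true (by simp) (by simp)),
    isACOrder_iff.2 (h.of_or hno and true (by simp) (by simp))⟩

theorem ABCDOrder.IsABOrder.noInduced_twoPlusTwo {X : Type*} [PartialOrder X]
    (h : IsABOrder X) : NoInduced TwoPlusTwo X := by
  obtain ⟨c, t, h⟩ := isABOrder_iff.1 h
  exact h.noInduced_twoPlusTwo (by decide)

theorem ABCDOrder.IsACOrder.noInduced_twoPlusTwo {X : Type*} [PartialOrder X]
    (h : IsACOrder X) : NoInduced TwoPlusTwo X := by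
  obtain ⟨c, t, h⟩ := isACOrder_iff.1 h
  exact h.noInduced_twoPlusTwo (by decide)

theorem ABCDOrder.IsABOrder.noInduced_posetZ {X : Type*} [PartialOrder X]
    (h : IsABOrder X) : NoInduced PosetZ X := by
  obtain ⟨c, t, h⟩ := isABOrder_iff.1 h
  exact h.noInduced_posetZ

theorem mainTheorem5 {X : Type*} [PartialOrder X] [Finite X] :
    (ABCDOrder.IsCDOrder X → ABCDOrder.NoInduced ABCDOrder.TwoPlusTwo X →
      ABCDOrder.IsABOrder X ∧ ABCDOrder.IsACOrder X) ∧
    (ABCDOrder.IsACOrder X → ABCDOrder.NoInduced ABCDOrder.PosetZ X →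
      ABCDOrder.IsABOrder X ∧ ABCDOrder.IsCDOrder X) ∧
    (ABCDOrder.IsABOrder X → ABCDOrder.NoInduced ABCDOrder.PosetH X →
      ABCDOrder.IsCDOrder X ∧ ABCDOrder.IsACOrder X) ∧
    (¬ (ABCDOrder.IsABOrder X ∧ ABCDOrder.IsACOrder X ∧ ¬ ABCDOrder.IsCDOrder X) ∧
      ¬ (ABCDOrder.IsABOrder X ∧ ABCDOrder.IsCDOrder X ∧ ¬ ABCDOrder.IsACOrder X) ∧
      ¬ (ABCDOrder.IsACOrder X ∧ ABCDOrder.IsCDOrder X ∧ ¬ ABCDOrder.IsABOrder X)) := by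
  refine ⟨ABCDOrder.isABOrder_and_isACOrder_of_isCDOrder,
    ABCDOrder.isABOrder_and_isCDOrder_of_isACOrder,
    ABCDOrder.isCDOrder_and_isACOrder_of_isABOrder, ?_, ?_, ?_⟩
  · rintro ⟨hAB, hAC, hCD⟩
    exact hCD (ABCDOrder.isABOrder_and_isCDOrder_of_isACOrder hAC hAB.noInduced_posetZ).2
  · rintro ⟨hAB, hCD, hAC⟩
    exact hAC (ABCDOrder.isABOrder_and_isACOrder_of_isCDOrder hCD hAB.noInduced_twoPlusTwo).2
  · rintro ⟨hAC, hCD, hAB⟩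
    exact hAB (ABCDOrder.isABOrder_and_isACOrder_of_isCDOrder hCD hAC.noInduced_twoPlusTwo).1
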